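/- Theorem 1.2. For positive integers $s_1,\dots,s_r$, let $$t(s_1,\dots,s_r)=\sum_{1\le k_1<k_2<\cdots<k_r}\frac{1}{(2k_1-1)^{s_1}(2k_2-1)^{s_2}\cdots(2k_r-1)^{s_r}}$$ (the sum being over integers $k_1,\dots,k_r$) whenever this series converges, and let $\{2\}^d$ denote the sequence consisting of $d$ copies of $2$. Let $\zeta$ be the Riemann zeta function, so that $\zeta(0)=-\tfrac12$. Then for all nonnegative integers $a$ and $b$ the series defining $t(\{2\}^a,3,\{2\}^b)$ converges, the series on the right-hand side below converges absolutely, and $$t(\{2\}^a,3,\{2\}^b)=\frac{-2}{(2a+1)!}\left(\frac{\pi}{2}\right)^{2a+2b+2}\sum_{n=0}^{\infty}\frac{\zeta(2n)}{2^{2n}\,(2n+2a+1)(2n+2a+2)\cdots(2n+2a+2b+2)}.$$ -/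

import Mathlib

noncomputable section

/-- The index set of the series defining a multiple `t`-value of depth `r`: all integer tuples
`1 ≤ k₁ < k₂ < ⋯ < k_r`. For `r = 0` it consists of the empty tuple only. -/
abbrev IncreasingTuple (r : ℕ) : Type :=
  {k : Fin r → ℕ // StrictMono k ∧ ∀ i, 1 ≤ k i}

/-- The term `1 / ((2k₁ - 1)^{s₁} ⋯ (2k_r - 1)^{s_r})`, a real number,
where `s = [s₁, …, s_r]`. -/
def multipleTTerm (s : List ℕ) (k : IncreasingTuple s.length) : ℝ :=
  1 / ∏ i : Fin s.length, (2 * (k.1 i : ℝ) - 1) ^ s.get i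

/-- The multiple `t`-value
`t(s₁, …, s_r) = ∑_{1 ≤ k₁ < ⋯ < k_r} 1 / ((2k₁ - 1)^{s₁} ⋯ (2k_r - 1)^{s_r})`.
(As the sum over a one-point set of an empty product, `t(∅) = 1`.) -/
def multipleT (s : List ℕ) : ℝ :=
  ∑' k : IncreasingTuple s.length, multipleTTerm s k

/-- The index `({2}^a, 3, {2}^b)`. -/
def twoThreeTwo (a b : ℕ) : List ℕ :=
  List.replicate a 2 ++ [3] ++ List.replicate b 2

/-- The `n`-th term `ζ(2n) / (2^{2n} (2n+2a+1)(2n+2a+2)⋯(2n+2a+2b+2))`,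
with `ζ` the Riemann zeta function (analytically continued, so that `ζ(0) = -1/2`). -/
def lupuTerm (a b n : ℕ) : ℂ :=
  riemannZeta (2 * (n : ℂ)) /
    (2 ^ (2 * n) * ∏ j ∈ Finset.Icc (2 * a + 1) (2 * a + 2 * b + 2), (2 * (n : ℂ) + (j : ℂ)))

end

/-!
Both sides equal the integral
`cotIntegral a b = ∫₀^{π/2} u^{2a+1}/(2a+1)! · (π/2 - u)^{2b+1}/(2b+1)! · cot u du`.

For the `t`-value, group the tuples by the entry `k` that carries the exponent `3`. The entries
below `k` contribute a finite elementary symmetric sum `gapSum a 0 k`, and the entries above `k` an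
infinite one, `tailT ({2}^b) k`.
* The finite sums are, up to the coefficients of the arcsine series, the coefficients of the
  expansion of `u^{2a+1}/(2a+1)!` in odd powers of `sin u`. The expansion is proved by induction on
  `a`: the second derivative of the remainder at level `a + 1` is the remainder at level `a` plus a
  single nonnegative term that tends to `0` for `u < π/2`. So the remainders are nonnegative
  (`sinPartial_le`) and tend to `0` (`tendsto_sinPartial`).
* The infinite sums are the ratios `∫₀^{π/2} cos^{2k-1} x · x^{2b}/(2b)! dx / ∫₀^{π/2} cos^{2k-1}`
  (`tailT_replicate`). Two integrations by parts give the recursion in `k` over which the sum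
  telescopes, and the ratios vanish in the limit since `cos^m` concentrates at `0`.

Inserting the sine expansion into `cotIntegral a b` and integrating by dominated convergence
produces the product of both sums with `1/(2k-1)³` (`hasSum_cotIntegral`).

For the zeta series, the partial fractions of the cotangent give
`∑ ζ(2n) x^{2n} = -(πx/2) cot (πx)` for `0 < x < 1`; with `x = u/π ≤ 1/2` the series may be
integrated termwise against `u^{2a} (π/2 - u)^{2b+1}`, and each term is a Beta integral
(`hasSum_cotIntegral_zeta`).
-/

/-! ### Splitting the multiple sum at the exponent three -/

/-- The elementary symmetric sum `∑ 1 / ((2m₁ - 1)² ⋯ (2m_a - 1)²)` over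
`N < m₁ < ⋯ < m_a < k`. -/
noncomputable def gapSum : ℕ → ℕ → ℕ → ℝ
  | 0, _, _ => 1
  | a + 1, N, k => ∑ m ∈ Finset.Ioo N k, 1 / (2 * (m : ℝ) - 1) ^ 2 * gapSum a m k

lemma gapSum_succ (a N k : ℕ) : gapSum (a + 1) N k =
    ∑ m ∈ Finset.Ioo N k, 1 / (2 * (m : ℝ) - 1) ^ 2 * gapSum a m k := rfl

lemma gapSum_nonneg (a N k : ℕ) : 0 ≤ gapSum a N k := by
  induction a generalizing N with
  | zero => simp [gapSum]
  | succ a ih =>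
    exact Finset.sum_nonneg fun m _ => mul_nonneg (by positivity) (ih m)

lemma gapSum_succ_of_le (a : ℕ) {N k : ℕ} (h : k ≤ N + 1) : gapSum (a + 1) N k = 0 := by
  have : Finset.Ioo N k = ∅ := by
    ext m; simp; omega
  simp [gapSum, this]

/-- Splitting the tuples counted by `gapSum` according to whether the largest entry is `k`. -/
lemma gapSum_succ_succ (a N k : ℕ) (h : N < k) :
    gapSum (a + 1) N (k + 1) = gapSum (a + 1) N k + 1 / (2 * (k : ℝ) - 1) ^ 2 * gapSum a N k := by
  have hI : Finset.Ioo N (k + 1) = insert k (Finset.Ioo N k) := by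
    ext m; simp; omega
  induction a generalizing N with
  | zero => simp [gapSum, hI, add_comm]
  | succ a ih =>
    rw [gapSum_succ, hI, Finset.sum_insert (by simp), gapSum_succ_of_le _ le_rfl, mul_zero,
      zero_add, gapSum_succ (a + 1) N k, gapSum_succ a N k, Finset.mul_sum,
      ← Finset.sum_add_distrib]
    refine Finset.sum_congr rfl fun m hm => ?_
    rw [Finset.mem_Ioo] at hm
    rw [ih m hm.2 (by ext m; simp; omega)]
    ring

/-- The sum `∑ 1 / ((2k₁ - 1)^{s₁} ⋯ (2k_r - 1)^{s_r})` over `N < k₁ < ⋯ < k_r`, as an extended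
nonnegative real, defined by summing over `k₁` last. -/
noncomputable def tailT : List ℕ → ℕ → ENNReal
  | [], _ => 1
  | s :: ss, N => ∑' k : Set.Ioi N, ENNReal.ofReal (1 / (2 * ((k : ℕ) : ℝ) - 1) ^ s) * tailT ss k

/-- A strictly increasing tuple of length `r + 1` with entries `> N` is its first entry `k > N`
followed by a strictly increasing tuple of length `r` with entries `> k`. -/
def increasingTupleEquiv (r N : ℕ) :
    {k : Fin (r + 1) → ℕ // StrictMono k ∧ ∀ i, N < k i} ≃
      (Σ n : Set.Ioi N, {k : Fin r → ℕ // StrictMono k ∧ ∀ i, (n : ℕ) < k i}) where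
  toFun k := ⟨⟨k.1 0, k.2.2 0⟩, ⟨fun i => k.1 i.succ,
    fun _ _ h => k.2.1 (Fin.succ_lt_succ_iff.2 h), fun i => k.2.1 (Fin.succ_pos i)⟩⟩
  invFun p := ⟨Fin.cons p.1 p.2.1, by
    refine ⟨fun i j hij => ?_, fun i => ?_⟩
    · induction i using Fin.cases with
      | zero =>
        induction j using Fin.cases with
        | zero => exact absurd hij (lt_irrefl _)
        | succ j => exact p.2.2.2 j
      | succ i =>
        induction j using Fin.cases with
        | zero => exact absurd hij (Fin.not_lt_zero _)
        | succ j => exact p.2.2.1 (Fin.succ_lt_succ_iff.1 hij)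
    · refine Fin.cases ?_ (fun j => ?_) i
      · exact p.1.2
      · exact lt_trans p.1.2 (p.2.2.2 j)⟩
  left_inv k := by
    apply Subtype.ext
    exact Fin.cons_self_tail k.1
  right_inv p := by
    rcases p with ⟨n, k⟩
    rfl

lemma tsum_prod_eq_tailT (s : List ℕ) (N : ℕ) :
    ∑' k : {k : Fin s.length → ℕ // StrictMono k ∧ ∀ i, N < k i},
      ENNReal.ofReal (1 / ∏ i : Fin s.length, (2 * (k.1 i : ℝ) - 1) ^ s.get i) = tailT s N := by
  induction s generalizing N with
  | nil =>
    have : Unique {k : Fin ([] : List ℕ).length → ℕ // StrictMono k ∧ ∀ i, N < k i} :=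
      { default := ⟨fun i => i.elim0, fun i => i.elim0, fun i => i.elim0⟩
        uniq := fun k => Subtype.ext (funext fun i => i.elim0) }
    rw [tsum_eq_single default (fun b hb => absurd (Subsingleton.elim _ _) hb)]
    simp [tailT]
  | cons s ss ih =>
    have e := (increasingTupleEquiv ss.length N).symm.tsum_eq fun k => ENNReal.ofReal
      (1 / ∏ i : Fin (ss.length + 1), (2 * (k.1 i : ℝ) - 1) ^ (s :: ss).get i)
    refine e.symm.trans ?_
    rw [tailT, ENNReal.tsum_sigma']
    refine tsum_congr fun n => ?_
    rw [← ih n, ← ENNReal.tsum_mul_left]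
    refine tsum_congr fun k => ?_
    have hn : (1 : ℝ) ≤ (n : ℕ) := by
      have := n.2; simp only [Set.mem_Ioi] at this; exact_mod_cast (by omega : 1 ≤ (n : ℕ))
    rw [← ENNReal.ofReal_mul (by have : (0:ℝ) ≤ 2 * (n : ℕ) - 1 := by linarith
                                 positivity)]
    congr 1
    rw [Fin.prod_univ_succ]
    simp [increasingTupleEquiv, mul_comm]

/-- Carrying out the sum over the entries before the one with exponent `q` first turns it into the
finite sum `gapSum`. -/
lemma tailT_replicate_append (a q N : ℕ) (ss : List ℕ) :
    tailT (List.replicate a 2 ++ q :: ss) N =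
      ∑' k : ℕ, if N < k then ENNReal.ofReal (gapSum a N k) *
        (ENNReal.ofReal (1 / (2 * (k : ℝ) - 1) ^ q) * tailT ss k) else 0 := by
  induction a generalizing N with
  | zero =>
    simp only [List.replicate_zero, List.nil_append, tailT, gapSum, ENNReal.ofReal_one, one_mul]
    rw [tsum_subtype (Set.Ioi N) fun k : ℕ =>
      ENNReal.ofReal (1 / (2 * (k : ℝ) - 1) ^ q) * tailT ss k]
    simp [Set.indicator_apply]
  | succ a ih =>
    rw [List.replicate_succ, List.cons_append, tailT]
    simp_rw [ih]
    rw [tsum_subtype (Set.Ioi N) fun k : ℕ => ENNReal.ofReal (1 / (2 * (k : ℝ) - 1) ^ 2) *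
      ∑' k' : ℕ, if k < k' then ENNReal.ofReal (gapSum a k k') *
        (ENNReal.ofReal (1 / (2 * (k' : ℝ) - 1) ^ q) * tailT ss k') else 0]
    simp_rw [Set.indicator_apply, Set.mem_Ioi, ← ENNReal.tsum_mul_left]
    have : ∀ m : ℕ, (if N < m then ∑' k : ℕ, ENNReal.ofReal (1 / (2 * (m : ℝ) - 1) ^ 2) *
        (if m < k then ENNReal.ofReal (gapSum a m k) *
        (ENNReal.ofReal (1 / (2 * (k : ℝ) - 1) ^ q) * tailT ss k) else 0) else 0) =
        ∑' k : ℕ, if m ∈ Finset.Ioo N k then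
          ENNReal.ofReal (1 / (2 * (m : ℝ) - 1) ^ 2 * gapSum a m k) *
          (ENNReal.ofReal (1 / (2 * (k : ℝ) - 1) ^ q) * tailT ss k) else 0 := by
      intro m
      split_ifs with h
      · refine tsum_congr fun k => ?_
        simp only [Finset.mem_Ioo, h, true_and, mul_ite, mul_zero]
        rw [ENNReal.ofReal_mul (by positivity), mul_assoc]
      · simp [h]
    simp_rw [this]
    rw [ENNReal.tsum_comm]
    refine tsum_congr fun k => ?_
    rw [tsum_eq_sum (s := Finset.Ioo N k) (fun m hm => by rw [if_neg hm])]
    split_ifs with h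
    · rw [gapSum, ENNReal.ofReal_sum_of_nonneg fun m _ =>
        mul_nonneg (by positivity) (gapSum_nonneg a m k), Finset.sum_mul]
    · rw [Finset.Ioo_eq_empty_of_le (by omega), Finset.sum_empty]

open Real Filter Topology

/-! ### Cosine moments and the sum over the large entries -/

lemma hasDerivAt_pow_div_factorial (n : ℕ) (x : ℝ) :
    HasDerivAt (fun x : ℝ => x ^ (n + 1) / (n + 1).factorial) (x ^ n / n.factorial) x := by
  have := (hasDerivAt_pow (n + 1) x).div_const ((n + 1).factorial : ℝ)
  convert! this using 1
  have : (n.factorial : ℝ) ≠ 0 := by positivity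
  rw [Nat.factorial_succ]
  push_cast
  field_simp

/-- The moment `∫₀^{π/2} cosᵐ x · x^{2b} / (2b)! dx`. -/
noncomputable def cosMoment (b m : ℕ) : ℝ :=
  ∫ x in (0 : ℝ)..π / 2, cos x ^ m * (x ^ (2 * b) / (2 * b).factorial)

lemma cosMoment_zero (m : ℕ) : cosMoment 0 m = ∫ x in (0 : ℝ)..π / 2, cos x ^ m := by
  simp [cosMoment]

lemma cosMoment_zero_pos (m : ℕ) : 0 < cosMoment 0 m := by
  rw [cosMoment_zero]; exact EulerSine.integral_cos_pow_pos m

lemma cosMoment_nonneg (b m : ℕ) : 0 ≤ cosMoment b m := by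
  refine intervalIntegral.integral_nonneg (by positivity) fun x hx => ?_
  have := cos_nonneg_of_neg_pi_div_two_le_of_le (by linarith [hx.1, pi_pos]) hx.2
  have := hx.1
  positivity

lemma cosMoment_zero_add_two (m : ℕ) :
    ((m : ℝ) + 2) * cosMoment 0 (m + 2) = (m + 1) * cosMoment 0 m := by
  simp only [cosMoment_zero]
  rw [integral_cos_pow]
  simp
  field_simp

/-- Two integrations by parts; the boundary terms vanish because `cos (π / 2) = 0`. -/
lemma cosMoment_succ_add_two (b m : ℕ) :
    ((m : ℝ) + 2) ^ 2 * cosMoment (b + 1) (m + 2) + cosMoment b (m + 2) =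
      (m + 2) * (m + 1) * cosMoment (b + 1) m := by
  set F : ℝ → ℝ := fun x =>
    -((m + 2) * cos x ^ (m + 1) * sin x) * (x ^ (2 * b + 1 + 1) / (2 * b + 1 + 1).factorial) -
      cos x ^ (m + 2) * (x ^ (2 * b + 1) / (2 * b + 1).factorial) with hF
  have hd : ∀ x, HasDerivAt F
      ((m + 2) * (m + 1) * (cos x ^ m * (x ^ (2 * (b + 1)) / (2 * (b + 1)).factorial)) -
        ((m : ℝ) + 2) ^ 2 * (cos x ^ (m + 2) * (x ^ (2 * (b + 1)) / (2 * (b + 1)).factorial)) -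
        cos x ^ (m + 2) * (x ^ (2 * b) / (2 * b).factorial)) x := by
    intro x
    have h1 := ((((hasDerivAt_cos x).pow (m + 1)).const_mul ((m : ℝ) + 2)).mul
      (hasDerivAt_sin x)).neg.mul (hasDerivAt_pow_div_factorial (2 * b + 1) x)
    have h2 := ((hasDerivAt_cos x).pow (m + 2)).mul (hasDerivAt_pow_div_factorial (2 * b) x)
    convert! h1.sub h2 using 1
    have hs : sin x ^ 2 = 1 - cos x ^ 2 := by rw [← cos_sq_add_sin_sq x]; ring
    simp only [Pi.pow_apply, Pi.mul_apply, Pi.neg_apply, Nat.add_sub_cancel]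
    rw [show 2 * (b + 1) = 2 * b + 1 + 1 by ring, show m + 2 - 1 = m + 1 by omega]
    push_cast
    linear_combination (-(m + 2) * (m + 1) * cos x ^ m *
      (x ^ (2 * b + 1 + 1) / (2 * b + 1 + 1).factorial)) * hs
  have hint : ∀ c m, IntervalIntegrable
      (fun x : ℝ => cos x ^ m * (x ^ (2 * c) / (2 * c).factorial)) MeasureTheory.volume 0 (π / 2) :=
    fun c m => Continuous.intervalIntegrable (by fun_prop) _ _
  have := intervalIntegral.integral_eq_sub_of_hasDerivAt (a := 0) (b := π / 2)
    (fun x _ => hd x) (Continuous.intervalIntegrable (by fun_prop) _ _)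
  rw [intervalIntegral.integral_sub (((hint _ _).const_mul _).sub ((hint _ _).const_mul _))
      (hint _ _), intervalIntegral.integral_sub ((hint _ _).const_mul _) ((hint _ _).const_mul _),
    intervalIntegral.integral_const_mul, intervalIntegral.integral_const_mul] at this
  simp only [hF, cos_pi_div_two, sin_zero] at this
  simp only [cosMoment]
  have e : (0:ℝ) ^ (m + 1) = 0 := by simp
  have e' : (0:ℝ) ^ (m + 2) = 0 := by simp
  have e'' : (0:ℝ) ^ (2 * b + 1) = 0 := by simp
  rw [e, e', e''] at this
  linear_combination -this

/-- `cosMoment b` at an odd exponent `2k - 1`, normalised by the Wallis integral.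
The subtraction truncates, so that only `k ≥ 1` is meaningful. -/
noncomputable def cosRatio (b k : ℕ) : ℝ := cosMoment b (2 * k - 1) / cosMoment 0 (2 * k - 1)

lemma cosRatio_nonneg (b k : ℕ) : 0 ≤ cosRatio b k :=
  div_nonneg (cosMoment_nonneg _ _) (cosMoment_nonneg _ _)

lemma cosRatio_zero (k : ℕ) : cosRatio 0 k = 1 := div_self (cosMoment_zero_pos _).ne'

lemma cosRatio_succ (b k : ℕ) (hk : 1 ≤ k) :
    cosRatio (b + 1) k =
      cosRatio (b + 1) (k + 1) + 1 / (2 * ((k + 1 : ℕ) : ℝ) - 1) ^ 2 * cosRatio b (k + 1) := by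
  obtain ⟨j, rfl⟩ : ∃ j, k = j + 1 := ⟨k - 1, by omega⟩
  unfold cosRatio
  rw [show 2 * (j + 1) - 1 = 2 * j + 1 by omega, show 2 * (j + 1 + 1) - 1 = 2 * j + 1 + 2 by omega]
  have h0 := cosMoment_zero_add_two (2 * j + 1)
  have h1 := cosMoment_succ_add_two b (2 * j + 1)
  have p0 := cosMoment_zero_pos (2 * j + 1)
  have p1 := cosMoment_zero_pos (2 * j + 1 + 2)
  push_cast at *
  have e : cosMoment 0 (2 * j + 1) =
      ((2 * j + 1 + 2 : ℝ) * cosMoment 0 (2 * j + 1 + 2)) / (2 * j + 1 + 1) := by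
    rw [h0]; field_simp
  have e' : cosMoment (b + 1) (2 * j + 1) = ((2 * (j : ℝ) + 1 + 2) ^ 2 *
      cosMoment (b + 1) (2 * j + 1 + 2) + cosMoment b (2 * j + 1 + 2)) /
        ((2 * j + 1 + 2) * (2 * j + 1 + 1)) := by
    rw [h1]; field_simp
  rw [e, e', show 2 * ((j : ℝ) + 1 + 1) - 1 = 2 * j + 1 + 2 by ring]
  field_simp

/-- The mass of `cosᵐ` concentrates at `0`, where `x ^ (2 * (b + 1))` vanishes. -/
lemma tendsto_cosRatio (b : ℕ) : Tendsto (cosRatio (b + 1)) atTop (𝓝 0) := by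
  have h := EulerSine.tendsto_integral_cos_pow_mul_div
    (f := fun x : ℝ => ((x ^ (2 * (b + 1)) / (2 * (b + 1)).factorial : ℝ) : ℂ)) (by fun_prop)
  have h2 : Tendsto (fun k : ℕ => 2 * k - 1) atTop atTop :=
    tendsto_atTop_mono (fun k => by simp only [id]; omega) tendsto_id
  have h3 := (Complex.continuous_re.tendsto _).comp (h.comp h2)
  convert! h3 using 1
  · ext k
    simp only [Function.comp, cosRatio, cosMoment_zero]
    rw [← Complex.ofReal_re (cosMoment _ _ / _), cosMoment]
    congr 1
    push_cast
    congr 1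
    rw [← intervalIntegral.integral_ofReal]
    push_cast
    rfl
  · simp

/-- The cosine ratios are the tails `∑_{k < k₁ < ⋯ < k_b} 1 / ((2k₁ - 1)² ⋯ (2k_b - 1)²)`. -/
lemma tailT_replicate (b k : ℕ) (hk : 1 ≤ k) :
    tailT (List.replicate b 2) k = ENNReal.ofReal (cosRatio b k) := by
  induction b generalizing k with
  | zero => simp [tailT, cosRatio_zero]
  | succ b ih =>
    have hs : HasSum (fun i : ℕ =>
        1 / (2 * ((k + i + 1 : ℕ) : ℝ) - 1) ^ 2 * cosRatio b (k + i + 1)) (cosRatio (b + 1) k) := by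
      rw [hasSum_iff_tendsto_nat_of_nonneg fun i =>
        mul_nonneg (by positivity) (cosRatio_nonneg _ _)]
      have : ∀ n, ∑ i ∈ Finset.range n, 1 / (2 * ((k + i + 1 : ℕ) : ℝ) - 1) ^ 2 *
          cosRatio b (k + i + 1) = cosRatio (b + 1) k - cosRatio (b + 1) (n + k) := by
        intro n
        induction n with
        | zero => simp
        | succ n ihn =>
          rw [Finset.sum_range_succ, ihn, cosRatio_succ b (n + k) (by omega),
            show k + n + 1 = n + k + 1 by ring, show n + 1 + k = n + k + 1 by ring]
          ring
      simp_rw [this]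
      simpa using tendsto_const_nhds.sub ((tendsto_add_atTop_iff_nat k).2 (tendsto_cosRatio b))
    rw [← hs.tsum_eq, ENNReal.ofReal_tsum_of_nonneg
      (fun i => mul_nonneg (by positivity) (cosRatio_nonneg _ _)) hs.summable,
      List.replicate_succ, tailT]
    let e : ℕ ≃ Set.Ioi k :=
      { toFun := fun i => ⟨k + i + 1, by simp only [Set.mem_Ioi]; omega⟩
        invFun := fun m => m - k - 1
        left_inv := fun i => by simp only; omega
        right_inv := fun ⟨m, hm⟩ => by
          simp only [Set.mem_Ioi] at hm
          exact Subtype.ext (by simp only; omega) }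
    rw [← e.tsum_eq]
    refine tsum_congr fun i => ?_
    rw [ih _ (by simp [e]), ENNReal.ofReal_mul (by positivity)]
    rfl

/-! ### Expansion of odd powers of the angle in powers of the sine -/

/-- The coefficients of the series `arcsin y = ∑ₖ arcsinCoeff k * y ^ (2 * k + 1)`, given by the
ratio of consecutive coefficients. -/
noncomputable def arcsinCoeff : ℕ → ℝ
  | 0 => 1
  | k + 1 => (2 * (k : ℝ) + 1) ^ 2 / ((2 * k + 2) * (2 * k + 3)) * arcsinCoeff k

lemma arcsinCoeff_nonneg (k : ℕ) : 0 ≤ arcsinCoeff k := by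
  induction k with
  | zero => simp [arcsinCoeff]
  | succ k ih => rw [arcsinCoeff]; positivity

lemma arcsinCoeff_le_one (k : ℕ) : arcsinCoeff k ≤ 1 := by
  induction k with
  | zero => simp [arcsinCoeff]
  | succ k ih =>
    rw [arcsinCoeff]
    refine mul_le_one₀ ?_ (arcsinCoeff_nonneg k) ih
    rw [div_le_one (by positivity)]
    nlinarith [(Nat.cast_nonneg k : (0 : ℝ) ≤ k)]

/-- The arcsine coefficients are reciprocal to the Wallis integrals, up to a factor. -/
lemma arcsinCoeff_mul_cosMoment (k : ℕ) :
    arcsinCoeff k * cosMoment 0 (2 * k + 1) = 1 / (2 * (k : ℝ) + 1) ^ 2 := by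
  induction k with
  | zero => simp [arcsinCoeff, cosMoment_zero]
  | succ k ih =>
    have h := cosMoment_zero_add_two (2 * k + 1)
    push_cast at h
    rw [arcsinCoeff, show 2 * (k + 1) + 1 = 2 * k + 1 + 2 by ring]
    have h' : cosMoment 0 (2 * k + 1 + 2) =
        (2 * k + 1 + 1) * cosMoment 0 (2 * k + 1) / (2 * k + 1 + 2) := by
      rw [← h]; field_simp
    rw [h']
    field_simp at ih ⊢
    push_cast
    linear_combination ((2 * k + 2) * (2 * k + 3) ^ 2 : ℝ) * ih

/-- The coefficient of `sin u ^ (2 * k + 1)` in the expansion of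
`u ^ (2 * a + 1) / (2 * a + 1)!`. -/
noncomputable def sinCoeff (a k : ℕ) : ℝ := arcsinCoeff k * gapSum a 0 (k + 1)

lemma sinCoeff_nonneg (a k : ℕ) : 0 ≤ sinCoeff a k :=
  mul_nonneg (arcsinCoeff_nonneg k) (gapSum_nonneg _ _ _)

lemma sinCoeff_zero_succ (k : ℕ) :
    (2 * (k : ℝ) + 3) * (2 * k + 2) * sinCoeff 0 (k + 1) = (2 * k + 1) ^ 2 * sinCoeff 0 k := by
  simp only [sinCoeff, gapSum, arcsinCoeff]
  field_simp

/-- Comparison of coefficients in `f'' = g`, for `f` and `g` the expansions at levels `a + 1`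
and `a`. -/
lemma sinCoeff_succ_succ (a k : ℕ) :
    (2 * (k : ℝ) + 3) * (2 * k + 2) * sinCoeff (a + 1) (k + 1) =
      (2 * k + 1) ^ 2 * sinCoeff (a + 1) k + sinCoeff a k := by
  simp only [sinCoeff, arcsinCoeff]
  rw [gapSum_succ_succ a 0 (k + 1) (by omega)]
  push_cast
  rw [show 2 * ((k : ℝ) + 1) - 1 = 2 * k + 1 by ring]
  field_simp

/-- A crude polynomial bound, which powers of `sin u < 1` beat. -/
lemma sinCoeff_le (a k : ℕ) : sinCoeff a k ≤ ((k : ℝ) + 1) ^ a := by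
  have h : gapSum a 0 (k + 1) ≤ ((k : ℝ) + 1) ^ a := by
    induction k generalizing a with
    | zero =>
      cases a with
      | zero => simp [gapSum]
      | succ a => rw [gapSum_succ_of_le a le_rfl]; positivity
    | succ k ih =>
      cases a with
      | zero => simp [gapSum]
      | succ a =>
        rw [gapSum_succ_succ a 0 (k + 1) (by omega)]
        push_cast
        have h1 : 1 / (2 * ((k : ℝ) + 1) - 1) ^ 2 ≤ 1 := by
          rw [div_le_one (by nlinarith [(Nat.cast_nonneg k : (0 : ℝ) ≤ k)])]
          nlinarith [(Nat.cast_nonneg k : (0 : ℝ) ≤ k)]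
        have h2 : 1 / (2 * ((k : ℝ) + 1) - 1) ^ 2 * gapSum a 0 (k + 1) ≤ ((k : ℝ) + 1) ^ a :=
          (mul_le_of_le_one_left (gapSum_nonneg _ _ _) h1).trans (ih a)
        have h3 : ((k : ℝ) + 1) ^ a ≤ ((k : ℝ) + 1 + 1) ^ a := by gcongr; linarith
        have h4 := ih (a + 1)
        have h5 : ((k : ℝ) + 1) * ((k : ℝ) + 1) ^ a ≤ ((k : ℝ) + 1) * ((k : ℝ) + 1 + 1) ^ a := by
          gcongr
        rw [pow_succ _ a] at h4 ⊢
        linarith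
  exact (mul_le_of_le_one_left (gapSum_nonneg _ _ _) (arcsinCoeff_le_one k)).trans h

/-- The partial sums of the expansion of `u ^ (2 * a + 1) / (2 * a + 1)!` in powers of `sin u`. -/
noncomputable def sinPartial (a K : ℕ) (u : ℝ) : ℝ :=
  ∑ k ∈ Finset.range K, sinCoeff a k * sin u ^ (2 * k + 1)

lemma sinPartial_nonneg (a K : ℕ) {u : ℝ} (hu : 0 ≤ sin u) : 0 ≤ sinPartial a K u :=
  Finset.sum_nonneg fun k _ => mul_nonneg (sinCoeff_nonneg a k) (by positivity)

/-- The derivative of `sinPartial`. -/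
noncomputable def sinPartialDeriv (a K : ℕ) (u : ℝ) : ℝ :=
  ∑ k ∈ Finset.range K, sinCoeff a k * ((2 * k + 1) * sin u ^ (2 * k) * cos u)

lemma hasDerivAt_sinPartial (a K : ℕ) (u : ℝ) :
    HasDerivAt (sinPartial a K) (sinPartialDeriv a K u) u := by
  unfold sinPartial sinPartialDeriv
  refine HasDerivAt.fun_sum fun k _ => ?_
  convert! ((hasDerivAt_sin u).pow (2 * k + 1)).const_mul (sinCoeff a k) using 2
  push_cast
  simp

/-- The second derivative of one power of the sine. -/
lemma hasDerivAt_sin_pow_mul_cos (k : ℕ) (u : ℝ) :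
    HasDerivAt (fun u : ℝ => (2 * (k : ℝ) + 1) * sin u ^ (2 * k) * cos u)
      ((2 * k + 1) * (2 * k) * sin u ^ (2 * k - 1) - (2 * k + 1) ^ 2 * sin u ^ (2 * k + 1)) u := by
  convert! (((hasDerivAt_sin u).pow (2 * k)).const_mul (2 * (k : ℝ) + 1)).mul
    (hasDerivAt_cos u) using 1
  simp only [Pi.pow_apply]
  cases k with
  | zero => simp
  | succ k =>
    have hc : cos u ^ 2 = 1 - sin u ^ 2 := by rw [← cos_sq_add_sin_sq u]; ring
    rw [show 2 * (k + 1) - 1 = 2 * k + 1 by omega]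
    push_cast
    linear_combination (-(2 * ((k : ℝ) + 1) + 1) * (2 * (k + 1)) * sin u ^ (2 * k + 1)) * hc

lemma hasDerivAt_sinPartialDeriv (a K : ℕ) (u : ℝ) :
    HasDerivAt (sinPartialDeriv a K) (∑ k ∈ Finset.range K, sinCoeff a k *
      ((2 * k + 1) * (2 * k) * sin u ^ (2 * k - 1) - (2 * k + 1) ^ 2 * sin u ^ (2 * k + 1))) u :=
  HasDerivAt.fun_sum fun k _ => (hasDerivAt_sin_pow_mul_cos k u).const_mul _

lemma hasDerivAt_sinPartialDeriv_zero (K : ℕ) (u : ℝ) :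
    HasDerivAt (sinPartialDeriv 0 (K + 1))
      (-((2 * K + 1) ^ 2 * sinCoeff 0 K * sin u ^ (2 * K + 1))) u := by
  convert hasDerivAt_sinPartialDeriv 0 (K + 1) u using 1
  induction K with
  | zero => simp
  | succ K ih =>
    rw [Finset.sum_range_succ, ← ih, show 2 * (K + 1) - 1 = 2 * K + 1 by omega]
    push_cast
    linear_combination (-sin u ^ (2 * K + 1)) * sinCoeff_zero_succ K

/-- The second derivative telescopes to the partial sum at the previous level, except for the
last term. -/
lemma hasDerivAt_sinPartialDeriv_succ (a K : ℕ) (u : ℝ) :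
    HasDerivAt (sinPartialDeriv (a + 1) (K + 1))
      (sinPartial a K u - (2 * K + 1) ^ 2 * sinCoeff (a + 1) K * sin u ^ (2 * K + 1)) u := by
  convert hasDerivAt_sinPartialDeriv (a + 1) (K + 1) u using 1
  induction K with
  | zero => simp [sinPartial]
  | succ K ih =>
    rw [Finset.sum_range_succ, ← ih, show 2 * (K + 1) - 1 = 2 * K + 1 by omega, sinPartial,
      sinPartial, Finset.sum_range_succ]
    push_cast
    linear_combination (-sin u ^ (2 * K + 1)) * sinCoeff_succ_succ a K

lemma sinPartial_zero_right (a K : ℕ) : sinPartial a K 0 = 0 := by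
  simp [sinPartial]

lemma sinPartialDeriv_zero_right (a K : ℕ) :
    sinPartialDeriv a (K + 1) 0 = if a = 0 then 1 else 0 := by
  rw [sinPartialDeriv, Finset.sum_range_succ', Finset.sum_eq_zero (fun k _ => by simp)]
  cases a with
  | zero => simp [sinCoeff, arcsinCoeff, gapSum]
  | succ a => simp [sinCoeff, gapSum_succ_of_le]

/-- A function with `h 0 = h' 0 = 0` and `h'' ≥ 0` on `[0, u]` is nonnegative at `u`. -/
lemma nonneg_of_second_deriv_nonneg {h h' h'' : ℝ → ℝ} {u : ℝ} (hu : 0 ≤ u)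
    (d1 : ∀ t, HasDerivAt h (h' t) t) (d2 : ∀ t, HasDerivAt h' (h'' t) t)
    (h0 : h 0 = 0) (h0' : h' 0 = 0) (hpos : ∀ t ∈ Set.Icc 0 u, 0 ≤ h'' t) : 0 ≤ h u := by
  have m2 : MonotoneOn h' (Set.Icc 0 u) :=
    monotoneOn_of_deriv_nonneg (convex_Icc 0 u) (fun t _ => (d2 t).continuousAt.continuousWithinAt)
      (fun t _ => (d2 t).differentiableAt.differentiableWithinAt)
      fun t ht => (d2 t).deriv ▸ hpos t (interior_subset ht)
  have m1 : MonotoneOn h (Set.Icc 0 u) :=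
    monotoneOn_of_deriv_nonneg (convex_Icc 0 u) (fun t _ => (d1 t).continuousAt.continuousWithinAt)
      (fun t _ => (d1 t).differentiableAt.differentiableWithinAt)
      fun t ht => by
        rw [(d1 t).deriv, ← h0']
        exact m2 ⟨le_rfl, hu⟩ (interior_subset ht) (interior_subset ht).1
  rw [← h0]
  exact m1 ⟨le_rfl, hu⟩ ⟨hu, le_rfl⟩ hu

lemma sin_nonneg_of_mem_Icc {t : ℝ} (ht : t ∈ Set.Icc 0 (π / 2)) : 0 ≤ sin t :=
  sin_nonneg_of_nonneg_of_le_pi ht.1 (by linarith [ht.2, pi_pos])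

/-- The remainder of the expansion in powers of the sine is nonnegative, by induction on `a`: its
second derivative is the remainder for `a - 1` plus a nonnegative term. -/
lemma sinPartial_le (a K : ℕ) {u : ℝ} (hu : u ∈ Set.Icc 0 (π / 2)) :
    sinPartial a K u ≤ u ^ (2 * a + 1) / (2 * a + 1).factorial := by
  have hsin : ∀ t ∈ Set.Icc 0 u, 0 ≤ sin t := fun t ht =>
    sin_nonneg_of_mem_Icc ⟨ht.1, ht.2.trans hu.2⟩
  induction a generalizing K u with
  | zero =>
    cases K with
    | zero => have := hu.1; simp [sinPartial, this]
    | succ K =>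
      have := nonneg_of_second_deriv_nonneg (h := fun t => t - sinPartial 0 (K + 1) t) hu.1
        (fun t => (hasDerivAt_id t).sub (hasDerivAt_sinPartial 0 (K + 1) t))
        (fun t => (hasDerivAt_sinPartialDeriv_zero K t).const_sub 1)
        (by simp [sinPartial_zero_right]) (by simp [sinPartialDeriv_zero_right])
        (fun t ht => by
          have := hsin t ht
          have := sinCoeff_nonneg 0 K
          rw [neg_neg]
          positivity)
      simpa using this
  | succ a ih =>
    cases K with
    | zero => have := hu.1; simp only [sinPartial, Finset.range_zero, Finset.sum_empty]; positivity
    | succ K =>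
      have := nonneg_of_second_deriv_nonneg (u := u)
        (h := fun t => t ^ (2 * a + 1 + 1 + 1) / (2 * a + 1 + 1 + 1).factorial -
          sinPartial (a + 1) (K + 1) t) hu.1
        (fun t => (hasDerivAt_pow_div_factorial _ t).sub (hasDerivAt_sinPartial (a + 1) (K + 1) t))
        (fun t => (hasDerivAt_pow_div_factorial _ t).sub (hasDerivAt_sinPartialDeriv_succ a K t))
        (by simp [sinPartial_zero_right]) (by simp [sinPartialDeriv_zero_right])
        (fun t ht => by
          have h1 := hsin t ht
          have h2 := sinCoeff_nonneg (a + 1) K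
          have h3 := ih K (u := t) ⟨ht.1, ht.2.trans hu.2⟩
            fun s hs => hsin s ⟨hs.1, hs.2.trans ht.2⟩
          have : 0 ≤ (2 * (K : ℝ) + 1) ^ 2 * sinCoeff (a + 1) K * sin t ^ (2 * K + 1) := by
            positivity
          linarith)
      exact sub_nonneg.1 this

lemma tendsto_sinCoeff_mul_pow (a : ℕ) {s : ℝ} (hs : 0 ≤ s) (hs1 : s < 1) :
    Tendsto (fun K : ℕ => (2 * (K : ℝ) + 1) ^ 2 * sinCoeff a K * s ^ (2 * K + 1)) atTop (𝓝 0) := by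
  have h := (tendsto_pow_const_mul_const_pow_of_lt_one (a + 2) hs hs1).comp
    (tendsto_atTop_mono (fun k : ℕ => (by simp only [id]; omega : id k ≤ 2 * k + 1)) tendsto_id)
  refine tendsto_of_tendsto_of_tendsto_of_le_of_le tendsto_const_nhds h (fun K => ?_) fun K => ?_
  · have := sinCoeff_nonneg a K
    positivity
  · simp only [Function.comp]
    push_cast
    rw [pow_add _ a 2, mul_comm ((2 * (K : ℝ) + 1) ^ a)]
    gcongr
    refine (sinCoeff_le a K).trans ?_
    gcongr
    linarith [(Nat.cast_nonneg K : (0 : ℝ) ≤ K)]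

/-- The expansion in powers of the sine converges to `u ^ (2 * a + 1) / (2 * a + 1)!`, uniformly
on `[0, u]` for `u < π / 2`. -/
lemma eventually_sub_sinPartial_le (a : ℕ) {u : ℝ} (hu : u ∈ Set.Ico 0 (π / 2)) {δ : ℝ}
    (hδ : 0 < δ) :
    ∀ᶠ K in atTop, ∀ t ∈ Set.Icc 0 u,
      t ^ (2 * a + 1) / (2 * a + 1).factorial - sinPartial a K t ≤ δ := by
  have hsu : ∀ t ∈ Set.Icc 0 u, 0 ≤ sin t ∧ sin t ≤ sin u := fun t ht =>
    ⟨sin_nonneg_of_mem_Icc ⟨ht.1, ht.2.trans hu.2.le⟩,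
      sin_le_sin_of_le_of_le_pi_div_two (by linarith [ht.1, pi_pos]) hu.2.le ht.2⟩
  have hs0 : 0 ≤ sin u := (hsu u ⟨hu.1, le_rfl⟩).1
  have hs1 : sin u < 1 := by
    rw [← sin_pi_div_two]
    exact sin_lt_sin_of_lt_of_le_pi_div_two (by linarith [hu.1, pi_pos]) le_rfl hu.2
  have hB : ∀ a, ∀ ε > 0, ∀ᶠ K : ℕ in atTop, ∀ t ∈ Set.Icc 0 u,
      (2 * (K : ℝ) + 1) ^ 2 * sinCoeff a K * sin t ^ (2 * K + 1) ≤ ε := by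
    intro a ε hε
    filter_upwards [(tendsto_sinCoeff_mul_pow a hs0 hs1).eventually_le_const hε] with K hK t ht
    refine le_trans ?_ hK
    have := sinCoeff_nonneg a K
    have := (hsu t ht).1
    have := (hsu t ht).2
    gcongr
  -- Since `t < π / 2 < 2`, integrating a bound `ε` twice costs a factor `t ^ 2 / 2 ≤ 2`.
  have hsq : ∀ t ∈ Set.Icc 0 u, t ^ 2 ≤ 4 := fun t ht => by
    nlinarith [ht.1, ht.2, hu.2, pi_lt_four, pi_pos]
  have hquad : ∀ ε t : ℝ, HasDerivAt (fun t : ℝ => ε * t ^ 2 / 2) (ε * t) t := fun ε t => by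
    convert! ((hasDerivAt_pow 2 t).const_mul ε).div_const 2 using 1
    simp; ring
  have hlin : ∀ ε t : ℝ, HasDerivAt (fun t : ℝ => ε * t) ε t := fun ε t => by
    simpa using (hasDerivAt_id t).const_mul ε
  induction a generalizing δ with
  | zero =>
    rw [← map_add_atTop_eq_nat 1, eventually_map]
    filter_upwards [hB 0 (δ / 4) (by positivity)] with K hK t ht
    have := nonneg_of_second_deriv_nonneg
      (h := fun t => δ / 4 * t ^ 2 / 2 - (t - sinPartial 0 (K + 1) t)) ht.1
      (fun t => (hquad _ t).sub ((hasDerivAt_id t).sub (hasDerivAt_sinPartial 0 (K + 1) t)))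
      (fun t => (hlin _ t).sub ((hasDerivAt_sinPartialDeriv_zero K t).const_sub 1))
      (by simp [sinPartial_zero_right]) (by simp [sinPartialDeriv_zero_right])
      (fun s hs => by have := hK s ⟨hs.1, hs.2.trans ht.2⟩; linarith)
    have h4 := hsq t ht
    simp only [mul_zero, zero_add, pow_one, Nat.factorial_one, Nat.cast_one, div_one]
    nlinarith
  | succ a ih =>
    rw [← map_add_atTop_eq_nat 1, eventually_map]
    filter_upwards [hB (a + 1) (δ / 4) (by positivity), ih (δ := δ / 4) (by positivity)]
      with K hK hK' t ht
    have := nonneg_of_second_deriv_nonneg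
      (h := fun t => δ / 2 * t ^ 2 / 2 - (t ^ (2 * a + 1 + 1 + 1) / (2 * a + 1 + 1 + 1).factorial -
          sinPartial (a + 1) (K + 1) t)) ht.1
      (fun t => (hquad _ t).sub
        ((hasDerivAt_pow_div_factorial _ t).sub (hasDerivAt_sinPartial (a + 1) (K + 1) t)))
      (fun t => (hlin _ t).sub
        ((hasDerivAt_pow_div_factorial _ t).sub (hasDerivAt_sinPartialDeriv_succ a K t)))
      (by simp [sinPartial_zero_right]) (by simp [sinPartialDeriv_zero_right])
      (fun s hs => by
        have h1 := hK s ⟨hs.1, hs.2.trans ht.2⟩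
        have h2 := hK' s ⟨hs.1, hs.2.trans ht.2⟩
        linarith)
    have h4 := hsq t ht
    rw [show 2 * (a + 1) + 1 = 2 * a + 1 + 1 + 1 by ring]
    nlinarith

lemma tendsto_sinPartial (a : ℕ) {u : ℝ} (hu : u ∈ Set.Ico 0 (π / 2)) :
    Tendsto (fun K => sinPartial a K u) atTop (𝓝 (u ^ (2 * a + 1) / (2 * a + 1).factorial)) := by
  rw [Metric.tendsto_atTop']
  intro ε hε
  obtain ⟨N, hN⟩ := eventually_atTop.1 (eventually_sub_sinPartial_le a hu (half_pos hε))
  refine ⟨N, fun K hK => ?_⟩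
  have h1 := hN K hK.le u ⟨hu.1, le_rfl⟩
  have h2 := sinPartial_le a K ⟨hu.1, hu.2.le⟩
  rw [dist_eq, abs_lt]
  constructor <;> linarith

/-! ### The cotangent integral as a multiple `t`-value -/

/-- The integral `∫₀^{π/2} u^{2a+1}/(2a+1)! · (π/2 - u)^{2b+1}/(2b+1)! · cot u du`. -/
noncomputable def cotIntegral (a b : ℕ) : ℝ :=
  ∫ u in (0 : ℝ)..π / 2, u ^ (2 * a + 1) / (2 * a + 1).factorial *
    ((π / 2 - u) ^ (2 * b + 1) / (2 * b + 1).factorial) * (cos u / sin u)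

lemma hasDerivAt_sub_pow_div_factorial (c : ℝ) (n : ℕ) (x : ℝ) :
    HasDerivAt (fun x : ℝ => (c - x) ^ (n + 1) / (n + 1).factorial)
      (-((c - x) ^ n / n.factorial)) x := by
  convert! (hasDerivAt_pow_div_factorial n (c - x)).comp x ((hasDerivAt_id x).const_sub c) using 1
  ring

/-- Integration by parts; the reflection `u ↦ π / 2 - u` turns sines into cosines. -/
lemma integral_sin_pow_mul_cos_mul (b k : ℕ) :
    ∫ u in (0 : ℝ)..π / 2, sin u ^ (2 * k) * cos u *
      ((π / 2 - u) ^ (2 * b + 1) / (2 * b + 1).factorial) =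
      1 / (2 * (k : ℝ) + 1) * cosMoment b (2 * k + 1) := by
  have hd : ∀ u, HasDerivAt (fun u : ℝ => sin u ^ (2 * k + 1) / (2 * k + 1) *
      ((π / 2 - u) ^ (2 * b + 1) / (2 * b + 1).factorial))
      (sin u ^ (2 * k) * cos u * ((π / 2 - u) ^ (2 * b + 1) / (2 * b + 1).factorial) -
        1 / (2 * (k : ℝ) + 1) *
          (sin u ^ (2 * k + 1) * ((π / 2 - u) ^ (2 * b) / (2 * b).factorial))) u := by
    intro u
    convert! (((hasDerivAt_sin u).pow (2 * k + 1)).div_const (2 * (k : ℝ) + 1)).mul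
      (hasDerivAt_sub_pow_div_factorial (π / 2) (2 * b) u) using 1
    simp only [Pi.pow_apply, Nat.add_sub_cancel]
    push_cast
    field_simp
    ring
  have h := intervalIntegral.integral_eq_sub_of_hasDerivAt (a := 0) (b := π / 2)
    (fun u _ => hd u) (Continuous.intervalIntegrable (by fun_prop) _ _)
  rw [intervalIntegral.integral_sub (Continuous.intervalIntegrable (by fun_prop) _ _)
    (Continuous.intervalIntegrable (by fun_prop) _ _), intervalIntegral.integral_const_mul] at h
  have hm : cosMoment b (2 * k + 1) = ∫ u in (0 : ℝ)..π / 2,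
      sin u ^ (2 * k + 1) * ((π / 2 - u) ^ (2 * b) / (2 * b).factorial) := by
    have := intervalIntegral.integral_comp_sub_left (a := 0) (b := π / 2)
      (fun x : ℝ => cos x ^ (2 * k + 1) * (x ^ (2 * b) / (2 * b).factorial)) (π / 2)
    simp only [cos_pi_div_two_sub, sub_self, sub_zero] at this
    rw [cosMoment, this]
  rw [hm]
  simp at h
  simp
  linarith

lemma mul_cos_le_sin {u : ℝ} (hu : u ∈ Set.Icc 0 (π / 2)) : u * cos u ≤ sin u := by
  rcases hu.2.eq_or_lt with rfl | h
  · simp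
  · have hc : 0 < cos u := cos_pos_of_mem_Ioo ⟨by linarith [hu.1, pi_pos], h⟩
    have := le_tan hu.1 h
    rwa [tan_eq_sin_div_cos, le_div_iff₀ hc] at this

/-- The terms of `t({2}^a, 3, {2}^b)`, grouped by the entry `k + 1` with exponent `3`. -/
lemma hasSum_cotIntegral (a b : ℕ) :
    HasSum (fun k : ℕ => gapSum a 0 (k + 1) * (1 / (2 * (k : ℝ) + 1) ^ 3 * cosRatio b (k + 1)))
      (cotIntegral a b) := by
  rw [hasSum_iff_tendsto_nat_of_nonneg fun k =>
    mul_nonneg (gapSum_nonneg _ _ _) (mul_nonneg (by positivity) (cosRatio_nonneg _ _))]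
  set V : ℝ → ℝ := fun u => (π / 2 - u) ^ (2 * b + 1) / (2 * b + 1).factorial with hV
  -- The partial sums of the integrand with the factor `1 / sin u` cancelled, hence
  -- continuous at `0`.
  set F : ℕ → ℝ → ℝ := fun K u =>
    ∑ k ∈ Finset.range K, sinCoeff a k * (sin u ^ (2 * k) * cos u * V u) with hF
  have hFI : ∀ K, ∑ k ∈ Finset.range K,
      gapSum a 0 (k + 1) * (1 / (2 * (k : ℝ) + 1) ^ 3 * cosRatio b (k + 1)) =
      ∫ u in (0 : ℝ)..π / 2, F K u := by
    intro K
    rw [hF, intervalIntegral.integral_finsetSum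
      fun k _ => Continuous.intervalIntegrable (by fun_prop) _ _]
    refine Finset.sum_congr rfl fun k _ => ?_
    rw [intervalIntegral.integral_const_mul, hV, integral_sin_pow_mul_cos_mul, cosRatio,
      show 2 * (k + 1) - 1 = 2 * k + 1 by omega, sinCoeff]
    have h := arcsinCoeff_mul_cosMoment k
    have := cosMoment_zero_pos (2 * k + 1)
    rw [← eq_div_iff this.ne'] at h
    rw [h]
    field_simp
  have hFP : ∀ K, ∀ u, 0 < u → u < π / 2 → F K u = sinPartial a K u * V u * (cos u / sin u) := by
    intro K u hu hu'
    have hs : sin u ≠ 0 := (sin_pos_of_pos_of_lt_pi hu (by linarith)).ne'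
    rw [hF, sinPartial, Finset.sum_mul, Finset.sum_mul]
    refine Finset.sum_congr rfl fun k _ => ?_
    field_simp
    ring
  simp_rw [hFI]
  have hne : ∀ᵐ u : ℝ, u ≠ π / 2 := MeasureTheory.Measure.ae_ne _ _
  have hmem : ∀ᵐ u : ℝ, u ∈ Set.uIoc 0 (π / 2) → 0 < u ∧ u < π / 2 := by
    filter_upwards [hne] with u hu hu'
    rw [Set.uIoc_of_le (by positivity)] at hu'
    exact ⟨hu'.1, lt_of_le_of_ne hu'.2 hu⟩
  refine intervalIntegral.tendsto_integral_filter_of_dominated_convergence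
    (fun u => u ^ (2 * a) / (2 * a + 1).factorial * V u) ?_ ?_ ?_ ?_
  · exact Eventually.of_forall fun K =>
      (Continuous.aestronglyMeasurable (by fun_prop)).restrict
  · refine Eventually.of_forall fun K => ?_
    filter_upwards [hmem] with u hu hu'
    obtain ⟨h0, h1⟩ := hu hu'
    have hs : 0 < sin u := sin_pos_of_pos_of_lt_pi h0 (by linarith)
    have hc : 0 ≤ cos u := cos_nonneg_of_neg_pi_div_two_le_of_le (by linarith) h1.le
    have hV0 : 0 ≤ V u := by
      have : 0 ≤ π / 2 - u := by linarith
      simp only [hV]; positivity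
    have hp := sinPartial_nonneg a K hs.le
    rw [hFP K u h0 h1, norm_of_nonneg (by positivity)]
    calc sinPartial a K u * V u * (cos u / sin u)
        ≤ u ^ (2 * a + 1) / (2 * a + 1).factorial * V u * (cos u / sin u) := by
          gcongr
          exact sinPartial_le a K ⟨h0.le, h1.le⟩
      _ = u ^ (2 * a) / (2 * a + 1).factorial * V u * (u * cos u / sin u) := by ring
      _ ≤ u ^ (2 * a) / (2 * a + 1).factorial * V u * 1 := by
          gcongr
          rw [div_le_one hs]
          exact mul_cos_le_sin ⟨h0.le, h1.le⟩
      _ = _ := mul_one _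
  · exact Continuous.intervalIntegrable (by fun_prop) _ _
  · filter_upwards [hmem] with u hu hu'
    obtain ⟨h0, h1⟩ := hu hu'
    simp_rw [hFP _ u h0 h1]
    exact ((tendsto_sinPartial a ⟨h0.le, h1⟩).mul_const _).mul_const _

lemma cotIntegral_nonneg (a b : ℕ) : 0 ≤ cotIntegral a b :=
  (hasSum_cotIntegral a b).nonneg fun _ =>
    mul_nonneg (gapSum_nonneg _ _ _) (mul_nonneg (by positivity) (cosRatio_nonneg _ _))

lemma tailT_twoThreeTwo (a b : ℕ) :
    tailT (twoThreeTwo a b) 0 = ENNReal.ofReal (cotIntegral a b) := by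
  rw [twoThreeTwo, List.append_assoc, List.singleton_append, tailT_replicate_append,
    tsum_eq_zero_add' ENNReal.summable, ← (hasSum_cotIntegral a b).tsum_eq,
    ENNReal.ofReal_tsum_of_nonneg (fun k => mul_nonneg (gapSum_nonneg _ _ _)
      (mul_nonneg (by positivity) (cosRatio_nonneg _ _))) (hasSum_cotIntegral a b).summable]
  simp only [lt_irrefl, if_false, zero_add]
  refine tsum_congr fun k => ?_
  rw [if_pos (by omega), tailT_replicate b (k + 1) (by omega),
    ENNReal.ofReal_mul (gapSum_nonneg _ _ _), ENNReal.ofReal_mul (by positivity)]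
  push_cast
  rw [show 2 * ((k : ℝ) + 1) - 1 = 2 * k + 1 by ring]

/-- The multiple `t`-value `t({2}^a, 3, {2}^b)` as a cotangent integral. -/
lemma hasSum_multipleTTerm (a b : ℕ) :
    HasSum (multipleTTerm (twoThreeTwo a b)) (cotIntegral a b) := by
  have hnn : ∀ k, 0 ≤ multipleTTerm (twoThreeTwo a b) k := fun k =>
    one_div_nonneg.2 <| Finset.prod_nonneg fun i _ => pow_nonneg (by
      have : (1 : ℝ) ≤ k.1 i := by exact_mod_cast k.2.2 i
      linarith) _
  have h : ∑' k, ENNReal.ofReal (multipleTTerm (twoThreeTwo a b) k) =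
      ENNReal.ofReal (cotIntegral a b) :=
    (tsum_prod_eq_tailT (twoThreeTwo a b) 0).trans (tailT_twoThreeTwo a b)
  have hs : Summable (multipleTTerm (twoThreeTwo a b)) := by
    have := ENNReal.summable_toReal (h ▸ ENNReal.ofReal_ne_top)
    simpa only [ENNReal.toReal_ofReal (hnn _)] using this
  rw [← ENNReal.ofReal_tsum_of_nonneg hnn hs,
    ENNReal.ofReal_eq_ofReal_iff (tsum_nonneg hnn) (cotIntegral_nonneg a b)] at h
  exact h ▸ hs.hasSum

/-! ### The cotangent integral as a zeta series -/

/-- The values `ζ(2n)` of the Riemann zeta function as real numbers; at `n = 0`, where the Dirichlet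
series diverges, this is `ζ(0) = -1/2`. -/
noncomputable def evenZeta (n : ℕ) : ℝ :=
  if n = 0 then -1 / 2 else ∑' k : ℕ, 1 / ((k : ℝ) + 1) ^ (2 * n)

lemma riemannZeta_two_mul_eq_evenZeta (n : ℕ) : riemannZeta (2 * (n : ℂ)) = evenZeta n := by
  rcases Nat.eq_zero_or_pos n with rfl | hn
  · simp [evenZeta, riemannZeta_zero]
  · have h := zeta_eq_tsum_one_div_nat_add_one_cpow (s := ((2 * n : ℕ) : ℂ)) (by
      rw [Complex.natCast_re]; exact_mod_cast (by omega : 1 < 2 * n))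
    simp only [Complex.cpow_natCast] at h
    rw [evenZeta, if_neg hn.ne', Complex.ofReal_tsum]
    push_cast at h ⊢
    exact h

lemma summable_one_div_nat_add_one_pow {n : ℕ} (hn : n ≠ 0) :
    Summable fun k : ℕ => 1 / ((k : ℝ) + 1) ^ (2 * n) := by
  have := (summable_nat_add_iff 1).2
    (Real.summable_one_div_nat_pow.2 (by omega : 1 < 2 * n))
  simpa using this

lemma abs_evenZeta_le (n : ℕ) : |evenZeta n| ≤ evenZeta 1 + 1 := by
  have h1 : 0 ≤ evenZeta 1 := by
    rw [evenZeta, if_neg one_ne_zero]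
    exact tsum_nonneg fun k => by positivity
  rcases eq_or_ne n 0 with rfl | hn
  · rw [show evenZeta 0 = -1 / 2 by simp [evenZeta], abs_of_neg (by norm_num)]
    linarith
  · have h2 : evenZeta n ≤ evenZeta 1 := by
      rw [evenZeta, if_neg hn, evenZeta, if_neg one_ne_zero]
      refine (summable_one_div_nat_add_one_pow hn).tsum_le_tsum (fun k => ?_)
        (summable_one_div_nat_add_one_pow one_ne_zero)
      have : (1 : ℝ) ≤ k + 1 := by linarith [(Nat.cast_nonneg k : (0 : ℝ) ≤ k)]
      gcongr
      omega
    have h3 : 0 ≤ evenZeta n := by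
      rw [evenZeta, if_neg hn]
      exact tsum_nonneg fun k => by positivity
    rw [abs_of_nonneg h3]
    linarith

/-- The partial fraction expansion of the cotangent. -/
lemma hasSum_cot_partial_fractions {x : ℝ} (hx0 : 0 < x) (hx1 : x < 1) :
    HasSum (fun k : ℕ => x ^ 2 / (((k : ℝ) + 1) ^ 2 - x ^ 2))
      (1 / 2 - π * x / 2 * (cos (π * x) / sin (π * x))) := by
  have hz : (x : ℂ) ∈ Complex.integerComplement := by
    rintro ⟨n, hn⟩
    have hn' : (n : ℝ) = x := by exact_mod_cast hn
    rw [← hn'] at hx0 hx1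
    have h0 : 0 < n := by exact_mod_cast hx0
    have h1 : n < 1 := by exact_mod_cast hx1
    omega
  have h := ((summable_cotTerm hz).hasSum.mul_left (-(x : ℂ) / 2))
  have e := cot_series_rep' hz
  change _ = ∑' n, cotTerm x n at e
  rw [← e] at h
  rw [← Complex.hasSum_ofReal]
  convert! h using 1
  · ext k
    have h1 : (((k : ℝ) + 1 : ℝ) : ℂ) ^ 2 - (x : ℂ) ^ 2 ≠ 0 := by
      have : ((k : ℝ) + 1) ^ 2 - x ^ 2 ≠ 0 := by
        have := (Nat.cast_nonneg k : (0 : ℝ) ≤ k)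
        nlinarith
      exact_mod_cast this
    have h2 : (x : ℂ) - (k + 1) ≠ 0 := by
      have : x - (k + 1) ≠ 0 := by
        have := (Nat.cast_nonneg k : (0 : ℝ) ≤ k)
        linarith
      exact_mod_cast this
    have h3 : (x : ℂ) + (k + 1) ≠ 0 := by
      have : x + (k + 1) ≠ 0 := by positivity
      exact_mod_cast this
    push_cast at h1 ⊢
    rw [cotTerm]
    field_simp
    ring
  · have : (x : ℂ) ≠ 0 := by exact_mod_cast hx0.ne'
    rw [Complex.cot]
    push_cast
    field_simp
    ring

/-- The generating function of the values `ζ(2n)`. -/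
lemma hasSum_evenZeta_mul_pow {x : ℝ} (hx0 : 0 < x) (hx1 : x < 1) :
    HasSum (fun n : ℕ => evenZeta n * x ^ (2 * n))
      (-(π * x / 2 * (cos (π * x) / sin (π * x)))) := by
  have hk := hasSum_cot_partial_fractions hx0 hx1
  have hgeo : ∀ k : ℕ, HasSum (fun n : ℕ => (x ^ 2 / ((k : ℝ) + 1) ^ 2) ^ (n + 1))
      (x ^ 2 / (((k : ℝ) + 1) ^ 2 - x ^ 2)) := by
    intro k
    have hk1 : (1 : ℝ) ≤ (k + 1) ^ 2 := by nlinarith [(Nat.cast_nonneg k : (0 : ℝ) ≤ k)]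
    have hlt : x ^ 2 < ((k : ℝ) + 1) ^ 2 := by nlinarith
    have := (hasSum_geometric_of_lt_one (r := x ^ 2 / ((k : ℝ) + 1) ^ 2) (by positivity)
      ((div_lt_one (by positivity)).2 hlt)).mul_left (x ^ 2 / ((k : ℝ) + 1) ^ 2)
    convert! this using 1
    · ext n; rw [pow_succ']
    · have : ((k : ℝ) + 1) ^ 2 - x ^ 2 ≠ 0 := by linarith
      field_simp
  have hsum : Summable fun p : ℕ × ℕ => (x ^ 2 / ((p.1 : ℝ) + 1) ^ 2) ^ (p.2 + 1) := by
    rw [summable_prod_of_nonneg fun p => by positivity]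
    exact ⟨fun k => (hgeo k).summable, by simpa only [(hgeo _).tsum_eq] using hk.summable⟩
  have hprod : HasSum (fun p : ℕ × ℕ => (x ^ 2 / ((p.1 : ℝ) + 1) ^ 2) ^ (p.2 + 1))
      (1 / 2 - π * x / 2 * (cos (π * x) / sin (π * x))) := by
    have := (hsum.hasSum.prod_fiberwise hgeo).unique hk
    exact this ▸ hsum.hasSum
  have hn : ∀ n : ℕ, HasSum (fun k : ℕ => (x ^ 2 / ((k : ℝ) + 1) ^ 2) ^ (n + 1))
      (evenZeta (n + 1) * x ^ (2 * (n + 1))) := by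
    intro n
    rw [evenZeta, if_neg n.succ_ne_zero]
    convert! (summable_one_div_nat_add_one_pow n.succ_ne_zero).hasSum.mul_right _ using 1
    ext k
    rw [div_pow, ← pow_mul, ← pow_mul, one_div_mul_eq_div]
  have := ((Equiv.prodComm ℕ ℕ).hasSum_iff.2 hprod).prod_fiberwise hn
  -- The term `n = 0` is the constant `ζ(0) = -1/2` by which the two sums differ.
  rw [← hasSum_nat_add_iff' 1]
  convert! this using 1
  simp [evenZeta]
  ring

/-- The Beta integral on `[0, c]` with integer exponents. -/
lemma integral_pow_div_factorial_mul (c : ℝ) (m l : ℕ) :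
    ∫ u in (0 : ℝ)..c, u ^ m / m.factorial * ((c - u) ^ l / l.factorial) =
      c ^ (m + l + 1) / (m + l + 1).factorial := by
  induction l generalizing m with
  | zero =>
    have := intervalIntegral.integral_eq_sub_of_hasDerivAt (a := 0) (b := c)
      (fun u _ => hasDerivAt_pow_div_factorial m u)
      (Continuous.intervalIntegrable (by fun_prop) _ _)
    simpa using this
  | succ l ih =>
    have h := intervalIntegral.integral_eq_sub_of_hasDerivAt (a := 0) (b := c)
      (fun u _ => (hasDerivAt_pow_div_factorial m u).mul (hasDerivAt_sub_pow_div_factorial c l u))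
      (Continuous.intervalIntegrable (by fun_prop) _ _)
    simp only [mul_neg, ← sub_eq_add_neg] at h
    rw [intervalIntegral.integral_sub (Continuous.intervalIntegrable (by fun_prop) _ _)
      (Continuous.intervalIntegrable (by fun_prop) _ _), ih (m + 1)] at h
    simp at h
    rw [show m + (l + 1) + 1 = m + 1 + l + 1 by ring]
    linarith

lemma prod_Icc_add (m p q : ℕ) :
    (∏ j ∈ Finset.Icc (p + 1) (p + q), ((m : ℝ) + j)) * (m + p).factorial =
      (m + p + q).factorial := by
  induction q with
  | zero => simp
  | succ q ih =>
    rw [← add_assoc p q 1, Finset.prod_Icc_succ_top (by omega), ← add_assoc (m + p) q 1,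
      Nat.factorial_succ]
    rw [Nat.cast_mul, ← ih]
    push_cast
    ring

/-- The cotangent integral, expanded term by term with the generating function of `ζ(2n)`. -/
lemma hasSum_cotIntegral_zeta (a b : ℕ) :
    HasSum (fun n : ℕ => -2 / ((2 * a + 1).factorial : ℝ) * (π / 2) ^ (2 * a + 2 * b + 2) *
      (evenZeta n / (2 ^ (2 * n) *
        ∏ j ∈ Finset.Icc (2 * a + 1) (2 * a + 2 * b + 2), (2 * (n : ℝ) + j))))
      (cotIntegral a b) := by
  set V : ℝ → ℝ := fun u => (π / 2 - u) ^ (2 * b + 1) / (2 * b + 1).factorial with hV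
  set F : ℕ → ℝ → ℝ := fun n u =>
    (-2 / ((2 * a + 1).factorial : ℝ) * (evenZeta n / π ^ (2 * n)) * (2 * n + 2 * a).factorial) *
      (u ^ (2 * n + 2 * a) / (2 * n + 2 * a).factorial * V u) with hF
  have hint : ∀ n, ∫ u in (0 : ℝ)..π / 2, F n u =
      -2 / ((2 * a + 1).factorial : ℝ) * (π / 2) ^ (2 * a + 2 * b + 2) *
      (evenZeta n / (2 ^ (2 * n) *
        ∏ j ∈ Finset.Icc (2 * a + 1) (2 * a + 2 * b + 2), (2 * (n : ℝ) + j))) := by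
    intro n
    rw [hF, intervalIntegral.integral_const_mul, hV, integral_pow_div_factorial_mul]
    have h := prod_Icc_add (2 * n) (2 * a) (2 * b + 2)
    rw [show 2 * n + 2 * a + (2 * b + 1) + 1 = 2 * n + 2 * a + (2 * b + 2) by ring, ← h]
    push_cast
    rw [show 2 * a + (2 * b + 2) = 2 * a + 2 * b + 2 by ring,
      show 2 * n + 2 * a + (2 * b + 2) = 2 * n + (2 * a + 2 * b + 2) by ring, pow_add,
      div_pow π 2 (2 * n)]
    have : ((2 * n + 2 * a).factorial : ℝ) ≠ 0 := by positivity
    have : ∏ j ∈ Finset.Icc (2 * a + 1) (2 * a + 2 * b + 2), (2 * (n : ℝ) + j) ≠ 0 :=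
      Finset.prod_ne_zero_iff.2 fun j hj => by
        have : 1 ≤ j := by rw [Finset.mem_Icc] at hj; omega
        positivity
    field_simp
  simp_rw [← hint]
  -- On `[0, π / 2]` the powers `(u / π) ^ (2 * n)` are at most `(1 / 4) ^ n`.
  set C : ℝ := 2 * (evenZeta 1 + 1) * ((π / 2) ^ (2 * a) * (π / 2) ^ (2 * b + 1)) with hC
  refine intervalIntegral.hasSum_integral_of_dominated_convergence
    (fun n _ => C * (1 / 4) ^ n) (fun n => (Continuous.aestronglyMeasurable (by fun_prop)).restrict)
    (fun n => ?_) ?_ ?_ ?_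
  · refine Eventually.of_forall fun u hu => ?_
    rw [Set.uIoc_of_le (by positivity)] at hu
    have h1 : 0 ≤ π / 2 - u := by linarith [hu.2]
    have h0 := hu.1
    have hfac : ∀ m : ℕ, (1 : ℝ) ≤ m.factorial := fun m => by exact_mod_cast m.factorial_pos
    have e : F n u = (1 / ((2 * a + 1).factorial * (2 * b + 1).factorial : ℝ)) *
        (-2 * evenZeta n * ((u ^ (2 * a) * (π / 2 - u) ^ (2 * b + 1)) * ((u / π) ^ 2) ^ n)) := by
      simp only [hF, hV]
      rw [pow_add, ← pow_mul, div_pow u]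
      have : ((2 * n + 2 * a).factorial : ℝ) ≠ 0 := by positivity
      field_simp
    have hq : (u / π) ^ 2 ≤ 1 / 4 := by
      have : u / π ≤ 1 / 2 := by rw [div_le_iff₀ pi_pos]; linarith [hu.2]
      have : 0 ≤ u / π := by positivity
      nlinarith
    rw [e, norm_mul, norm_mul, norm_mul, hC, mul_assoc (2 * (evenZeta 1 + 1))]
    have b1 : ‖1 / ((2 * a + 1).factorial * (2 * b + 1).factorial : ℝ)‖ ≤ 1 := by
      rw [norm_of_nonneg (by positivity), div_le_one (by positivity)]
      exact one_le_mul_of_one_le_of_one_le (hfac _) (hfac _)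
    refine (mul_le_of_le_one_left (by positivity) b1).trans ?_
    rw [norm_of_nonneg (by positivity : 0 ≤ u ^ (2 * a) * (π / 2 - u) ^ (2 * b + 1) *
      ((u / π) ^ 2) ^ n), norm_eq_abs, norm_eq_abs, show |(-2 : ℝ)| = 2 by norm_num]
    have b2 := abs_evenZeta_le n
    gcongr
    · linarith [(abs_nonneg _).trans b2]
    · exact hu.2
    · linarith
  · exact Eventually.of_forall fun u _ =>
      (summable_geometric_of_lt_one (by norm_num) (by norm_num)).mul_left _
  · exact intervalIntegrable_const
  · refine Eventually.of_forall fun u hu => ?_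
    rw [Set.uIoc_of_le (by positivity)] at hu
    have h0 := hu.1
    have hx : u / π < 1 := by rw [div_lt_one pi_pos]; linarith [hu.2, pi_pos]
    have h := (hasSum_evenZeta_mul_pow (x := u / π) (by positivity) hx).mul_left
      (-2 / ((2 * a + 1).factorial : ℝ) * u ^ (2 * a) * V u)
    rw [mul_div_cancel₀ _ pi_ne_zero] at h
    convert! h using 1
    · ext n
      simp only [hF]
      rw [pow_add, div_pow u]
      have : ((2 * n + 2 * a).factorial : ℝ) ≠ 0 := by positivity
      field_simp
    · rw [pow_succ]
      ring

lemma lupuTerm_eq (a b n : ℕ) : lupuTerm a b n = ((evenZeta n / (2 ^ (2 * n) *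
    ∏ j ∈ Finset.Icc (2 * a + 1) (2 * a + 2 * b + 2), (2 * (n : ℝ) + j)) : ℝ) : ℂ) := by
  rw [lupuTerm, riemannZeta_two_mul_eq_evenZeta]
  push_cast
  rfl

theorem theorem1p2 (a b : ℕ) :
    Summable (multipleTTerm (twoThreeTwo a b)) ∧
    Summable (lupuTerm a b) ∧
    ((multipleT (twoThreeTwo a b) : ℝ) : ℂ) =
      -2 / ((Nat.factorial (2 * a + 1) : ℕ) : ℂ) *
        ((Real.pi : ℂ) / 2) ^ (2 * a + 2 * b + 2) * ∑' n : ℕ, lupuTerm a b n := by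
  have h := hasSum_cotIntegral_zeta a b
  have hc : -2 / ((2 * a + 1).factorial : ℝ) * (π / 2) ^ (2 * a + 2 * b + 2) ≠ 0 :=
    mul_ne_zero (div_ne_zero (by norm_num) (by positivity)) (by positivity)
  have hs := (summable_mul_left_iff hc).1 h.summable
  refine ⟨(hasSum_multipleTTerm a b).summable, ?_, ?_⟩
  · simp_rw [funext (lupuTerm_eq a b)]
    exact Complex.summable_ofReal.2 hs
  · rw [multipleT, (hasSum_multipleTTerm a b).tsum_eq, ← h.tsum_eq, tsum_mul_left]
    simp_rw [lupuTerm_eq, ← Complex.ofReal_tsum]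
    push_cast
    rfl
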